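/- All Banach spaces are real and operators are bounded and linear; $X$ is a Banach space, $F$ is a Banach lattice, $X^*$ and $F^*$ are the topological duals, and $F^*$ is the Banach lattice ordered by $f\le g$ iff $f(x)\le g(x)$ for all $x\ge 0$ in $F$. A sequence $(x_n)_n$ in a Banach lattice is disjoint if $|x_m|\wedge|x_n|=0$ for all $m\ne n$. For a real number $p\ge 1$, a sequence $(x_n)_n$ in a Banach space $Z$ is weakly $p$-summable if $(z^*(x_n))_n\in\ell_p$ for every $z^*\in Z^*$. A Banach lattice $E$ has the disjoint property of order $p$ if every norm bounded disjoint sequence in $E$ is weakly $p$-summable. **Corollary 3.1.** Let $1\le p<\infty$, let $X$ be a Banach space, and let $F$ be a Banach lattice such that $F^*$ has the disjoint property of order $p$. For every bounded linear operator $T\colon X\to F$, with adjoint $T^*\colon F^*\to X^*$, the following are equivalent: (a) $T^*$ is disjoint $p$-convergent, that is, $\|T^*y_n^*\|\to 0$ for every disjoint weakly $p$-summable sequence $(y_n^*)_n$ in $F^*$. (b) $T^*$ is almost Dunford–Pettis, that is, $\|T^*y_n^*\|\to 0$ for every disjoint weakly null sequence $(y_n^*)_n$ in $F^*$. (c) $T$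 is almost limited, that is, $\|T^*y_n^*\|\to 0$ for every disjoint weak$^*$ null sequence $(y_n^*)_n$ in $F^*$. -/

import Mathlib

open Filter Topology

set_option linter.unusedSectionVars false

/-! ### The dual of a Banach lattice is a Banach lattice -/

namespace BanachLatticeDual

section

variable {F : Type*} [NormedAddCommGroup F] [NormedSpace ℝ F] [Lattice F] [HasSolidNorm F]
  [IsOrderedAddMonoid F]

/-- The values `f y` with `0 ≤ y ≤ x`. -/
def orderValues (f : StrongDual ℝ F) (x : F) : Set ℝ := f '' Set.Icc 0 x

theorem abs_apply_le (f : StrongDual ℝ F) {x y : F} (h : |y| ≤ |x|) : |f y| ≤ ‖f‖ * ‖x‖ :=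
  (f.le_opNorm y).trans
    (mul_le_mul_of_nonneg_left (norm_le_norm_of_abs_le_abs h) (norm_nonneg _))

theorem orderValues_bddAbove (f : StrongDual ℝ F) (x : F) : BddAbove (orderValues f x) := by
  refine ⟨‖f‖ * ‖x‖, ?_⟩
  rintro _ ⟨y, ⟨h0, h1⟩, rfl⟩
  refine (le_abs_self _).trans (abs_apply_le f ?_)
  rw [abs_of_nonneg h0, abs_of_nonneg (h0.trans h1)]
  exact h1

/-- On `x ≥ 0` this is `f⁺ x = sup {f y | 0 ≤ y ≤ x}`. -/
noncomputable def posFun (f : StrongDual ℝ F) (x : F) : ℝ := sSup (orderValues f x)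

theorem apply_le_posFun (f : StrongDual ℝ F) {x y : F} (h0 : 0 ≤ y) (h1 : y ≤ x) :
    f y ≤ posFun f x :=
  le_csSup (orderValues_bddAbove f x) ⟨y, ⟨h0, h1⟩, rfl⟩

theorem posFun_le (f : StrongDual ℝ F) {x : F} (hx : 0 ≤ x) {c : ℝ}
    (h : ∀ y, 0 ≤ y → y ≤ x → f y ≤ c) : posFun f x ≤ c := by
  refine csSup_le ⟨f 0, 0, ⟨le_rfl, hx⟩, rfl⟩ ?_
  rintro _ ⟨y, ⟨h0, h1⟩, rfl⟩
  exact h y h0 h1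

theorem posFun_nonneg (f : StrongDual ℝ F) {x : F} (hx : 0 ≤ x) : 0 ≤ posFun f x := by
  simpa using apply_le_posFun f le_rfl hx

theorem posFun_le_norm (f : StrongDual ℝ F) {x : F} (hx : 0 ≤ x) : posFun f x ≤ ‖f‖ * ‖x‖ := by
  refine posFun_le f hx fun y h0 h1 => (le_abs_self _).trans (abs_apply_le f ?_)
  rwa [abs_of_nonneg h0, abs_of_nonneg hx]

theorem posFun_add (f : StrongDual ℝ F) {x z : F} (hx : 0 ≤ x) (hz : 0 ≤ z) :
    posFun f (x + z) = posFun f x + posFun f z := by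
  apply le_antisymm
  · refine posFun_le f (add_nonneg hx hz) fun y h0 h1 => ?_
    have e : f y = f (y ⊓ x) + f (y - y ⊓ x) := by rw [← map_add]; congr 1; abel
    rw [e]
    refine add_le_add (apply_le_posFun f (le_inf h0 hx) inf_le_right)
      (apply_le_posFun f (sub_nonneg.2 inf_le_left) ?_)
    rw [sub_le_comm]
    exact le_inf (sub_le_self _ hz) (sub_le_iff_le_add.2 h1)
  · rw [← le_sub_iff_add_le]
    refine posFun_le f hx fun y h0 h1 => ?_
    rw [le_sub_comm]
    refine posFun_le f hz fun w k0 k1 => ?_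
    rw [le_sub_iff_add_le', ← map_add]
    exact apply_le_posFun f (add_nonneg h0 k0) (add_le_add h1 k1)

theorem posFun_sub_eq (f : StrongDual ℝ F) {a b c d : F} (ha : 0 ≤ a) (hb : 0 ≤ b) (hc : 0 ≤ c)
    (hd : 0 ≤ d) (h : a - b = c - d) : posFun f a - posFun f b = posFun f c - posFun f d := by
  have h' : a + d = c + b := by rwa [sub_eq_sub_iff_add_eq_add] at h
  have := congrArg (posFun f) h'
  rw [posFun_add f ha hd, posFun_add f hc hb] at this
  linarith

/-- The additive extension of `posFun f` from the positive cone to `F`. -/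
noncomputable def posHom (f : StrongDual ℝ F) : F →+ ℝ :=
  AddMonoidHom.mk' (fun x => posFun f x⁺ - posFun f x⁻) fun x y => by
    have h := posFun_sub_eq f (posPart_nonneg (x + y)) (negPart_nonneg (x + y))
      (add_nonneg (posPart_nonneg x) (posPart_nonneg y))
      (add_nonneg (negPart_nonneg x) (negPart_nonneg y))
      (by rw [posPart_sub_negPart, add_sub_add_comm, posPart_sub_negPart, posPart_sub_negPart])
    rw [posFun_add f (posPart_nonneg x) (posPart_nonneg y),
      posFun_add f (negPart_nonneg x) (negPart_nonneg y)] at h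
    rw [h]; ring

theorem posHom_apply (f : StrongDual ℝ F) (x : F) :
    posHom f x = posFun f x⁺ - posFun f x⁻ := rfl

theorem posHom_bound (f : StrongDual ℝ F) (x : F) : ‖posHom f x‖ ≤ ‖f‖ * ‖x‖ := by
  have hp : ‖x⁺‖ ≤ ‖x‖ := norm_le_norm_of_abs_le_abs (by
    rw [abs_of_nonneg (posPart_nonneg x), ← posPart_add_negPart]
    exact le_add_of_nonneg_right (negPart_nonneg x))
  have hn : ‖x⁻‖ ≤ ‖x‖ := norm_le_norm_of_abs_le_abs (by
    rw [abs_of_nonneg (negPart_nonneg x), ← posPart_add_negPart]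
    exact le_add_of_nonneg_left (posPart_nonneg x))
  have h1 := posFun_nonneg f (posPart_nonneg x)
  have h2 := posFun_nonneg f (negPart_nonneg x)
  have h3 := (posFun_le_norm f (posPart_nonneg x)).trans
    (mul_le_mul_of_nonneg_left hp (norm_nonneg f))
  have h4 := (posFun_le_norm f (negPart_nonneg x)).trans
    (mul_le_mul_of_nonneg_left hn (norm_nonneg f))
  rw [posHom_apply, Real.norm_eq_abs, abs_le]
  constructor <;> linarith

/-- The positive part `f⁺` of a continuous functional. -/
noncomputable def pos (f : StrongDual ℝ F) : StrongDual ℝ F :=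
  (posHom f).toRealLinearMap (AddMonoidHomClass.continuous_of_bound (posHom f) ‖f‖ (posHom_bound f))

theorem pos_apply (f : StrongDual ℝ F) {x : F} (hx : 0 ≤ x) : pos f x = posFun f x := by
  have h0 : posFun f (0 : F) = 0 := by simpa using posFun_add f (le_refl (0 : F)) le_rfl
  change posFun f x⁺ - posFun f x⁻ = _
  rw [posPart_of_nonneg hx, negPart_of_nonneg hx, h0, sub_zero]

/-- The order of the dual: `f ≤ g` if and only if `f x ≤ g x` for all `x ≥ 0`. -/
noncomputable instance instPartialOrder : PartialOrder (StrongDual ℝ F) where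
  le f g := ∀ x : F, 0 ≤ x → f x ≤ g x
  le_refl _ _ _ := le_rfl
  le_trans _ _ _ h k x hx := (h x hx).trans (k x hx)
  le_antisymm f g h k := by
    have e : ∀ x : F, 0 ≤ x → f x = g x := fun x hx => le_antisymm (h x hx) (k x hx)
    ext x
    rw [← posPart_sub_negPart x, map_sub, map_sub, e _ (posPart_nonneg x), e _ (negPart_nonneg x)]

theorem le_def {f g : StrongDual ℝ F} : f ≤ g ↔ ∀ x : F, 0 ≤ x → f x ≤ g x := Iff.rfl

theorem le_pos (f : StrongDual ℝ F) : f ≤ pos f := fun x hx => by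
  rw [pos_apply f hx]; exact apply_le_posFun f hx le_rfl

theorem pos_nonneg (f : StrongDual ℝ F) : 0 ≤ pos f := fun x hx => by
  rw [pos_apply f hx]; exact posFun_nonneg f hx

theorem pos_le {f g : StrongDual ℝ F} (h : f ≤ g) (h0 : 0 ≤ g) : pos f ≤ g := fun x hx => by
  rw [pos_apply f hx]
  refine posFun_le f hx fun y k0 k1 => (h y k0).trans ?_
  have := h0 (x - y) (sub_nonneg.2 k1)
  rw [zero_apply, map_sub] at this
  exact sub_nonneg.1 this

instance instIsOrderedAddMonoid : IsOrderedAddMonoid (StrongDual ℝ F) where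
  add_le_add_left f g h k x hx := by
    simpa using h x hx

/-- The lattice structure of the dual of a Banach lattice. The suprema and infima are those
of the order `f ≤ g ↔ ∀ x ≥ 0, f x ≤ g x`. -/
noncomputable instance instLattice : Lattice (StrongDual ℝ F) where
  sup f g := g + pos (f - g)
  le_sup_left f g := sub_le_iff_le_add'.1 (le_pos (f - g))
  le_sup_right f g := le_add_of_nonneg_right (pos_nonneg (f - g))
  sup_le _ g _ hf hg := le_sub_iff_add_le'.1
    (pos_le (sub_le_sub_right hf g) (sub_nonneg.2 hg))
  inf f g := f - pos (f - g)
  inf_le_left f g := sub_le_self f (pos_nonneg (f - g))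
  inf_le_right f g := sub_le_comm.1 (le_pos (f - g))
  le_inf _ f _ hf hg := le_sub_comm.1
    (pos_le (sub_le_sub_left hg f) (sub_nonneg.2 hf))

instance instIsOrderedModule : IsOrderedModule ℝ (StrongDual ℝ F) where
  smul_le_smul_of_nonneg_left c hc _ _ h x hx := mul_le_mul_of_nonneg_left (h x hx) hc
  smul_le_smul_of_nonneg_right f hf _ _ h x hx :=
    mul_le_mul_of_nonneg_right h (by simpa using hf x hx)

theorem abs_dual_apply_le (f : StrongDual ℝ F) {x : F} (hx : 0 ≤ x) : |f| x ≤ ‖f‖ * ‖x‖ := by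
  change (-f + pos (f - -f)) x ≤ _
  rw [add_apply, pos_apply _ hx, neg_apply,
    neg_add_le_iff_le_add']
  refine posFun_le _ hx fun y h0 h1 => ?_
  have hy : |y + y - x| ≤ |x| := by
    rw [abs_of_nonneg hx, abs_le']
    constructor
    · rw [sub_le_iff_le_add]; exact add_le_add h1 h1
    · rw [neg_sub]; exact sub_le_self _ (add_nonneg h0 h0)
  have := (le_abs_self _).trans (abs_apply_le f hy)
  simp only [map_sub, map_add, sub_apply, neg_apply]
    at this ⊢
  linarith

theorem abs_apply_le_abs_dual (f : StrongDual ℝ F) (x : F) : |f x| ≤ |f| |x| := by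
  have h1 := (le_abs_self f) x⁺ (posPart_nonneg x)
  have h2 := (le_abs_self f) x⁻ (negPart_nonneg x)
  have h3 := (neg_le_abs f) x⁺ (posPart_nonneg x)
  have h4 := (neg_le_abs f) x⁻ (negPart_nonneg x)
  have e : f x = f x⁺ - f x⁻ := by rw [← map_sub, posPart_sub_negPart]
  rw [← posPart_add_negPart x, map_add, e, abs_le]
  simp only [neg_apply] at h3 h4
  constructor <;> linarith

instance instHasSolidNorm : HasSolidNorm (StrongDual ℝ F) where
  solid f g h := by
    refine f.opNorm_le_bound (norm_nonneg g) fun x => ?_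
    have := (abs_apply_le_abs_dual f x).trans
      ((h |x| (abs_nonneg x)).trans (abs_dual_apply_le g (abs_nonneg x)))
    rwa [norm_abs_eq_norm] at this

end

end BanachLatticeDual

/-! ### Sequences in normed spaces and in Banach lattices -/

/-- `(x n)` converges to `0` in the weak topology. -/
def WeaklyNull {E : Type*} [NormedAddCommGroup E] [NormedSpace ℝ E] (x : ℕ → E) : Prop :=
  Tendsto (fun n => toWeakSpace ℝ E (x n)) atTop (𝓝 0)

/-- `(f n)` converges to `0` in the weak* topology. -/
def WeakStarNull {E : Type*} [NormedAddCommGroup E] [NormedSpace ℝ E]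
    (f : ℕ → StrongDual ℝ E) : Prop :=
  Tendsto (fun n => StrongDual.toWeakDual (f n)) atTop (𝓝 0)

/-- `(f (x n))` belongs to `ℓ_p` for every continuous linear functional `f`. -/
def WeaklyPSummable {E : Type*} [NormedAddCommGroup E] [NormedSpace ℝ E] (p : ℝ)
    (x : ℕ → E) : Prop :=
  ∀ f : StrongDual ℝ E, Summable fun n => |f (x n)| ^ p

/-- The terms are pairwise disjoint: `|x m| ∧ |x n| = 0` for `m ≠ n`. -/
def DisjointSeq {E : Type*} [AddCommGroup E] [Lattice E] (x : ℕ → E) : Prop :=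
  ∀ m n, m ≠ n → |x m| ⊓ |x n| = 0

/-- Every norm bounded disjoint sequence is weakly `p`-summable. -/
def HasDisjointProperty (E : Type*) [NormedAddCommGroup E] [NormedSpace ℝ E] [Lattice E]
    (p : ℝ) : Prop :=
  ∀ x : ℕ → E, DisjointSeq x → (∃ C : ℝ, ∀ n, ‖x n‖ ≤ C) → WeaklyPSummable p x

/-! ### Classes of operators -/

/-- Disjoint weakly `p`-summable sequences are mapped to norm null sequences. -/
def DisjointPConvergent {E Y : Type*} [NormedAddCommGroup E] [NormedSpace ℝ E] [Lattice E]
    [NormedAddCommGroup Y] [NormedSpace ℝ Y] (p : ℝ) (S : E →L[ℝ] Y) : Prop :=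
  ∀ x : ℕ → E, DisjointSeq x → WeaklyPSummable p x → Tendsto (fun n => S (x n)) atTop (𝓝 0)

/-- Disjoint weakly null sequences are mapped to norm null sequences. -/
def AlmostDunfordPettis {E Y : Type*} [NormedAddCommGroup E] [NormedSpace ℝ E] [Lattice E]
    [NormedAddCommGroup Y] [NormedSpace ℝ Y] (S : E →L[ℝ] Y) : Prop :=
  ∀ x : ℕ → E, DisjointSeq x → WeaklyNull x → Tendsto (fun n => S (x n)) atTop (𝓝 0)

/-- The adjoint `T* : F* → X*`, `f ↦ f ∘ T`. -/
noncomputable def adjointOp {X F : Type*} [NormedAddCommGroup X] [NormedSpace ℝ X]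
    [NormedAddCommGroup F] [NormedSpace ℝ F] (T : X →L[ℝ] F) :
    StrongDual ℝ F →L[ℝ] StrongDual ℝ X :=
  ContinuousLinearMap.precomp ℝ T

/-- The adjoint maps disjoint weak* null sequences of `F*` to norm null sequences of `X*`. -/
def AlmostLimited {X F : Type*} [NormedAddCommGroup X] [NormedSpace ℝ X]
    [NormedAddCommGroup F] [NormedSpace ℝ F] [Lattice F] [HasSolidNorm F] [IsOrderedAddMonoid F]
    (T : X →L[ℝ] F) : Prop :=
  ∀ f : ℕ → StrongDual ℝ F, DisjointSeq f → WeakStarNull f →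
    Tendsto (fun n => adjointOp T (f n)) atTop (𝓝 0)

/-! In `F*`, weak `p`-summability implies weak nullity, which implies weak* nullity; this gives (c)
⇒ (b) ⇒ (a) for every `T`. The disjoint property closes the cycle: by uniform boundedness a weak*
null sequence in `F*` is norm bounded, so if it is also disjoint it is weakly `p`-summable. The
three conditions therefore test `T*` on exactly the same sequences, and nothing about `T` itself
matters. The carrying lemmas are `WeaklyPSummable.weaklyNull`, `WeaklyNull.weakStarNull` and
`WeakStarNull.exists_norm_le`. -/

theorem weaklyNull_iff_forall_tendsto {E : Type*} [NormedAddCommGroup E] [NormedSpace ℝ E]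
    {x : ℕ → E} :
    WeaklyNull x ↔ ∀ f : StrongDual ℝ E, Tendsto (fun n => f (x n)) atTop (𝓝 0) := by
  -- By Hahn–Banach, functionals separate the points of `E`.
  have hinj : Function.Injective (topDualPairing ℝ E).flip := fun a b h =>
    (SeparatingDual.eq_iff_forall_dual_eq (R := ℝ)).2 fun f => LinearMap.congr_fun h f
  refine (WeakBilin.tendsto_iff_forall_eval_tendsto _ hinj).trans (forall_congr' fun f => ?_)
  -- The limit is written as the value of `f` at `0`, so that both sides agree definitionally.
  rw [← map_zero f]
  rfl

theorem weakStarNull_iff_forall_tendsto {E : Type*} [NormedAddCommGroup E] [NormedSpace ℝ E]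
    {f : ℕ → StrongDual ℝ E} :
    WeakStarNull f ↔ ∀ x : E, Tendsto (fun n => f n x) atTop (𝓝 0) := by
  refine tendsto_iff_forall_eval_tendsto_topDualPairing.trans (forall_congr' fun x => ?_)
  rw [← zero_apply (F := StrongDual ℝ E) x]
  rfl

/-- Each point of `E` acts on the dual through the canonical embedding into the bidual, so weak*
convergence tests fewer functionals than weak convergence. -/
theorem WeaklyNull.weakStarNull {E : Type*} [NormedAddCommGroup E] [NormedSpace ℝ E]
    {f : ℕ → StrongDual ℝ E} (hf : WeaklyNull f) : WeakStarNull f :=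
  weakStarNull_iff_forall_tendsto.2 fun x =>
    weaklyNull_iff_forall_tendsto.1 hf (NormedSpace.inclusionInDoubleDual ℝ E x)

/-- The terms of a summable series tend to `0`, and taking `p`-th roots preserves this. -/
theorem WeaklyPSummable.weaklyNull {E : Type*} [NormedAddCommGroup E] [NormedSpace ℝ E]
    {p : ℝ} (hp : 0 < p) {x : ℕ → E} (hx : WeaklyPSummable p x) : WeaklyNull x := by
  refine weaklyNull_iff_forall_tendsto.2 fun f => ?_
  rw [tendsto_zero_iff_abs_tendsto_zero]
  -- The base tends to `0`, where continuity of the power requires a nonnegative exponent.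
  have h := (hx f).tendsto_atTop_zero.rpow_const (p := p⁻¹) (Or.inr (inv_nonneg.2 hp.le))
  rw [Real.zero_rpow (inv_ne_zero hp.ne')] at h
  exact h.congr fun n => Real.rpow_rpow_inv (abs_nonneg _) hp.ne'

/-- Weak* null sequences in the dual of a Banach space are norm bounded. -/
theorem WeakStarNull.exists_norm_le {E : Type*} [NormedAddCommGroup E] [NormedSpace ℝ E]
    [CompleteSpace E] {f : ℕ → StrongDual ℝ E} (hf : WeakStarNull f) :
    ∃ C : ℝ, ∀ n, ‖f n‖ ≤ C := by
  -- Completeness of `E` enters here; pointwise boundedness holds because convergent real sequences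
  -- are bounded.
  refine banach_steinhaus fun x => ?_
  obtain ⟨C, hC⟩ := (Metric.isBounded_range_of_tendsto _
    (weakStarNull_iff_forall_tendsto.1 hf x)).exists_norm_le
  exact ⟨C, fun n => hC _ ⟨n, rfl⟩⟩

theorem corollary3p1 {X F : Type*} [NormedAddCommGroup X] [NormedSpace ℝ X] [CompleteSpace X]
    [NormedAddCommGroup F] [NormedSpace ℝ F] [CompleteSpace F]
    [Lattice F] [IsOrderedAddMonoid F] [IsOrderedModule ℝ F] [HasSolidNorm F]
    (p : ℝ) (hp : 1 ≤ p) (hF : HasDisjointProperty (StrongDual ℝ F) p) (T : X →L[ℝ] F) :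
    List.TFAE [DisjointPConvergent p (adjointOp T), AlmostDunfordPettis (adjointOp T),
      AlmostLimited T] := by
 
  -- The only implication that needs the disjoint property and the completeness of `F`.
  tfae_have 1 → 3 := fun h f hd hf => h f hd (hF f hd hf.exists_norm_le)
  tfae_have 3 → 2 := fun h f hd hf => h f hd hf.weakStarNull
  tfae_have 2 → 1 := fun h f hd hf => h f hd (hf.weaklyNull (zero_lt_one.trans_le hp))
  tfae_finish
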